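/- Let $\mathcal G$ be a weighted directed graph on $n\ge 1$ nodes with nonnegative weights $a_{ij}$, $a_{ii}=0$, where $a_{ij}>0$ exactly when there is an edge from node $j$ to node $i$; let $\mathcal N_i=\{j: a_{ij}>0\}$. Let $\bar l=\max_i\sum_{j\ne i}a_{ij}$ be its maximal weighted in-degree (the largest diagonal entry of its Laplacian). Let $C\in\mathbb R^{d\times d}$ be such that (Assumption 1) $1$ is a semi-simple eigenvalue of $C$ (geometric multiplicity equals algebraic multiplicity, which is at least $1$), all other eigenvalues $\lambda\in\mathbb C$ of $C$ satisfy $\operatorname{Re}\lambda<1$, and $c_{ii}\ge 0$ for all $i$. Suppose that $\mathcal G$ has a directed spanning tree, i.e. some subset of its edges forms a tree on all nodes in which a root node has no parent, every other node has exactly one parent, and every node is reached from the root. Suppose further that, for every eigenvalue $\lambda_k=|\lambda_k|e^{\jmath\theta_k}$ of $C$ (with $\jmath^2=-1$ and $\theta_k\in(-\pi,\pi]$ the argument of $\lambda_k$), $$\bar l<\min\left\{\frac{\bigl|1-|\lambda_k|\cos\theta_k\bigr|\,(1+\cos\theta_k)}{|\lambda_k|\sin^2\theta_k},\;0.5\right\},$$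 where for real $\lambda_k$ (for which the denominator vanishes) the first term is omitted, so that the requirement is $\bar l<0.5$. Then Model 1 reaches consensus: every solution $x_1,\dots,x_n:[0,\infty)\to\mathbb R^d$, with arbitrary initial values, of $$\dot x_i(t)=\sum_{j\in\mathcal N_i}a_{ij}\,C\bigl(x_j(t)-x_i(t)\bigr)+(C-I_d)\,x_i(t),\qquad i=1,\dots,n,$$ satisfies $\lim_{t\to\infty}\|x_i(t)-x_j(t)\|=0$ for all $i,j\in\{1,\dots,n\}$. -/

import Mathlib

open scoped Topology

noncomputable section

/-- A weighted directed graph on the nodes `1, …, n`, given by its weighted adjacency matrix: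
nonnegative weights `a i j` with zero diagonal. -/
structure WeightedDigraph (n : ℕ) where
  a : Matrix (Fin n) (Fin n) ℝ
  a_nonneg : ∀ i j, 0 ≤ a i j
  a_diag : ∀ i, a i i = 0

namespace WeightedDigraph

variable {n : ℕ} (G : WeightedDigraph n)

/-- `G.Edge i j`: the directed edge `(v_i, v_j)`, present iff `a_{ji} > 0`
(individual `j` takes the opinion of individual `i` into account). -/
def Edge (i j : Fin n) : Prop := 0 < G.a j i

open Classical in
/-- The incoming neighbours of node `i`: all `j` with an edge from `j` to `i`. -/
def inNeighbors (i : Fin n) : Finset (Fin n) := Finset.univ.filter (fun j => G.Edge j i)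

/-- The Laplacian: `l_{ii} = ∑_{k ≠ i} a_{ik}` and `l_{ij} = -a_{ij}` for `j ≠ i`. -/
def laplacian : Matrix (Fin n) (Fin n) ℝ :=
  fun i j => if i = j then ∑ k ∈ Finset.univ.erase i, G.a i k else -G.a i j

/-- The maximal weighted in-degree `max_i l_{ii}`. -/
def maxInDegree [NeZero n] : ℝ :=
  Finset.univ.sup' Finset.univ_nonempty (fun i => G.laplacian i i)

end WeightedDigraph

/-- The edges `T` form a directed spanning tree with the given root: the root has no parent, every
other node has exactly one parent, and every node is reached from the root. -/
def IsDirectedSpanningTree {n : ℕ} (T : Fin n → Fin n → Prop) (root : Fin n) : Prop :=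
  (∀ i, ¬ T i root) ∧ (∀ j, j ≠ root → ∃! i, T i j) ∧ ∀ j, Relation.ReflTransGen T root j

/-- Some subset of the edges of `G` forms a directed spanning tree. -/
def WeightedDigraph.HasDirectedSpanningTree {n : ℕ} (G : WeightedDigraph n) : Prop :=
  ∃ T : Fin n → Fin n → Prop, (∀ i j, T i j → G.Edge i j) ∧ ∃ root, IsDirectedSpanningTree T root

/-- A real square matrix regarded as a complex matrix. -/
def complexify {d : ℕ} (C : Matrix (Fin d) (Fin d) ℝ) : Matrix (Fin d) (Fin d) ℂ :=
  C.map Complex.ofReal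

/-- `μ` is a (complex) eigenvalue of the real matrix `C`. -/
def IsEigenvalueOf {d : ℕ} (C : Matrix (Fin d) (Fin d) ℝ) (μ : ℂ) : Prop :=
  Module.End.HasEigenvalue (Matrix.toLin' (complexify C)) μ

/-- The standing assumption on the logic matrix: `1` is an eigenvalue, it is semi-simple (geometric
and algebraic multiplicities agree), all other eigenvalues have real part less than `1`, and the
diagonal entries are nonnegative. -/
structure IsLogicMatrix {d : ℕ} (C : Matrix (Fin d) (Fin d) ℝ) : Prop where
  one_eigenvalue : IsEigenvalueOf C 1
  one_semisimple :
    Module.finrank ℂ (Module.End.eigenspace (Matrix.toLin' (complexify C)) 1) =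
      (complexify C).charpoly.rootMultiplicity 1
  re_lt_one : ∀ μ : ℂ, IsEigenvalueOf C μ → μ ≠ 1 → μ.re < 1
  diag_nonneg : ∀ i, 0 ≤ C i i

/-- `x` is a trajectory on `[0, ∞)` of Model 1 without stubborn individuals:
`x_i' = ∑_{j ∈ N_i} a_{ij} C (x_j - x_i) + (C - I) x_i` for every individual `i`. -/
def IsModelOneSolution {n d : ℕ} (G : WeightedDigraph n) (C : Matrix (Fin d) (Fin d) ℝ)
    (x : ℝ → Fin n → EuclideanSpace ℝ (Fin d)) : Prop :=
  ∀ t : ℝ, 0 ≤ t → ∀ i : Fin n,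
    HasDerivWithinAt (fun s => x s i)
      ((∑ j ∈ G.inNeighbors i, G.a i j • Matrix.toEuclideanLin C (x t j - x t i))
        + Matrix.toEuclideanLin (C - 1) (x t i))
      (Set.Ici 0) t

/-- Consensus of opinions: `‖x_i(t) - x_j(t)‖ → 0` as `t → ∞` for all individuals `i, j`. -/
def ReachesConsensus {n d : ℕ} (x : ℝ → Fin n → EuclideanSpace ℝ (Fin d)) : Prop :=
  ∀ i j : Fin n, Filter.Tendsto (fun t => ‖x t i - x t j‖) Filter.atTop (𝓝 0)

/-- The upper bound on the maximal in-degree attached to an eigenvalue `μ = |μ| e^{jθ}`: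
`min {|1 - |μ| cos θ| (1 + cos θ) / (|μ| sin² θ), 1/2}`. For real `μ` the denominator vanishes, the
first term is absent (`+∞`) and the bound is `1/2`. -/
def inDegreeBound (μ : ℂ) : ℝ :=
  if μ.im = 0 then 1 / 2
  else
    min (|1 - ‖μ‖ * Real.cos μ.arg| * (1 + Real.cos μ.arg) / (‖μ‖ * Real.sin μ.arg ^ 2)) (1 / 2)

end

/-! Since `C (x_j - x_i)` and `(C - I) x_i` combine, the model reads `x' = ((1 - L) ⊗ C) x - x`. As
`1 - L` fixes constant vectors, the differences with the root `r` satisfy a closed linear equation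
`y' = (P Q - 1) y`, where `P` is `1 - L` minus its row `r` and `Q` applies `C` at each node. `P` and
`Q` commute, so every eigenvalue of `P Q - 1` is `η μ - 1` with `η`, `μ` eigenvalues of `P` and `C`.
If `η ≠ 0`, the spanning tree excludes `η = 1` (maximum principle), and `η` is an eigenvalue of `1 -
L`, hence lies in a Gershgorin disc with centre `1 - l` and radius `l`. Then `Re (η μ) ≤ Re μ + l
(|μ| - Re μ)`, which the in-degree bound keeps below `1` for `μ ≠ 1`; for `μ = 1` the disc and `η ≠
1` suffice. So `y → 0`. -/

open Filter

/-! ### Stability of linear differential equations -/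

/-- A differentiable curve with `f' = lam f + g`, `Re lam < 0` and `g → 0` tends to `0`. -/
theorem tendsto_zero_of_hasDerivWithinAt_smul_add {E : Type*} [NormedAddCommGroup E]
    [NormedSpace ℂ E] {f g : ℝ → E} {lam : ℂ} (hlam : lam.re < 0)
    (hf : ∀ t : ℝ, 0 ≤ t → HasDerivWithinAt f (lam • f t + g t) (Set.Ici 0) t)
    (hg : Tendsto g atTop (𝓝 0)) : Tendsto f atTop (𝓝 0) := by
  set α : ℝ := -lam.re with hα
  have hα0 : 0 < α := by linarith
  have hnorm : ∀ t : ℝ, ‖Complex.exp (-(lam * t))‖ = Real.exp (α * t) := by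
    intro t
    rw [Complex.norm_exp]
    simp [hα]
  rw [tendsto_zero_iff_norm_tendsto_zero]
  rw [Metric.tendsto_atTop]
  intro ε hε
  obtain ⟨T₀, hT₀⟩ := (Metric.tendsto_atTop.1 hg) (α * ε / 2) (by positivity)
  set T : ℝ := max T₀ 0
  have hgT : ∀ t, T ≤ t → ‖g t‖ ≤ α * ε / 2 := fun t ht => by
    have := hT₀ t ((le_max_left _ _).trans ht)
    rw [dist_zero_right] at this
    exact this.le
  have hT0 : 0 ≤ T := le_max_right _ _
  -- Integrating factor: multiplying by `exp (-lam t)` cancels the linear term.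
  have hder : ∀ t : ℝ, 0 ≤ t → HasDerivWithinAt (fun s : ℝ => Complex.exp (-(lam * s)) • f s)
      (Complex.exp (-(lam * t)) • g t) (Set.Ici 0) t := by
    intro t ht
    have h1 : HasDerivAt (fun s : ℝ => Complex.exp (-(lam * s)))
        (Complex.exp (-(lam * t)) * (-(lam * 1))) t :=
      ((Complex.ofRealCLM.hasDerivAt (x := t)).const_mul lam).neg.cexp
    have h2 := h1.hasDerivWithinAt (s := Set.Ici 0) |>.smul (hf t ht)
    convert! h2 using 1
    simp only [smul_add, smul_smul]
    module
  set K : ℝ := ‖Complex.exp (-(lam * T)) • f T‖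
  have hbound : ∀ t, T ≤ t →
      ‖Complex.exp (-(lam * t)) • f t‖ ≤ K + ε / 2 * (Real.exp (α * t) - Real.exp (α * T)) := by
    intro t ht
    refine image_norm_le_of_norm_deriv_right_le_deriv_boundary
      (f := fun s : ℝ => Complex.exp (-(lam * s)) • f s)
      (f' := fun s : ℝ => Complex.exp (-(lam * s)) • g s)
      (B := fun s => K + ε / 2 * (Real.exp (α * s) - Real.exp (α * T)))
      (B' := fun s => ε / 2 * (Real.exp (α * s) * (α * 1))) (a := T) (b := t) ?_ ?_ ?_ ?_ ?_ ⟨ht, le_rfl⟩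
    · intro s hs
      exact ((hder s (hT0.trans hs.1)).continuousWithinAt).mono
        fun y hy => hT0.trans hy.1
    · intro s hs
      exact (hder s (hT0.trans hs.1)).mono fun y hy => (hT0.trans hs.1).trans hy
    · simp [K]
    · intro s
      exact ((((hasDerivAt_id s).const_mul α).exp.sub_const _).const_mul _).const_add _
    · intro s hs
      rw [norm_smul, hnorm]
      nlinarith [hgT s hs.1, Real.exp_pos (α * s)]
  have hlim : Tendsto (fun t : ℝ => K * Real.exp (-(α * t))) atTop (𝓝 0) := by
    have : Tendsto (fun t : ℝ => Real.exp (-(α * t))) atTop (𝓝 0) :=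
      Real.tendsto_exp_neg_atTop_nhds_zero.comp (tendsto_id.const_mul_atTop hα0)
    simpa using this.const_mul K
  obtain ⟨T₁, hT₁⟩ := (Metric.tendsto_atTop.1 hlim) (ε / 2) (by positivity)
  refine ⟨max T T₁, fun t ht => ?_⟩
  have h1 := hbound t ((le_max_left _ _).trans ht)
  have h2 := hT₁ t ((le_max_right _ _).trans ht)
  rw [norm_smul, hnorm] at h1
  rw [dist_zero_right, norm_norm]
  rw [dist_zero_right, Real.norm_eq_abs] at h2
  have h3 := (le_abs_self _).trans_lt h2
  rw [Real.exp_neg, ← div_eq_mul_inv, div_lt_iff₀ (Real.exp_pos _)] at h3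
  have h4 := Real.exp_pos (α * T)
  have h5 := Real.exp_pos (α * t)
  have h6 : Real.exp (α * t) * ‖f t‖ < Real.exp (α * t) * ε := by nlinarith
  exact lt_of_mul_lt_mul_left h6 h5.le

open Polynomial in
/-- A solution of `f' = B f` annihilated by `∏ (B - a)` with all `Re a < 0` tends to `0`. -/
theorem tendsto_zero_of_aeval_prod_eq_zero {E : Type*} [NormedAddCommGroup E] [NormedSpace ℂ E]
    [FiniteDimensional ℂ E] (B : Module.End ℂ E) (s : Multiset ℂ) (hs : ∀ a ∈ s, a.re < 0)
    (f : ℝ → E) (hf : ∀ t : ℝ, 0 ≤ t → HasDerivWithinAt f (B (f t)) (Set.Ici 0) t)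
    (h0 : ∀ t, aeval B (s.map (X - C ·)).prod (f t) = 0) : Tendsto f atTop (𝓝 0) := by
  induction s using Multiset.induction_on generalizing f with
  | empty =>
    have : f = 0 := by ext1 t; simpa using h0 t
    rw [this]
    exact tendsto_const_nhds
  | cons a s ih =>
    let D : Module.End ℂ E := B - algebraMap ℂ _ a
    have hD : ∀ v, D v = B v - a • v := fun v => by simp [D]
    refine tendsto_zero_of_hasDerivWithinAt_smul_add (g := fun t => D (f t))
      (hs a (Multiset.mem_cons_self _ _)) (fun t ht => ?_) ?_
    · simpa [hD] using hf t ht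
    · refine ih (fun b hb => hs b (Multiset.mem_cons_of_mem hb)) _ (fun t ht => ?_) fun t => ?_
      · have h1 := ((LinearMap.toContinuousLinearMap D).restrictScalars ℝ).hasFDerivAt
          |>.comp_hasDerivWithinAt t (hf t ht)
        convert! h1 using 1
        simp [hD]
      · have := h0 t
        -- The factors are swapped so that `B - a` acts first and the remaining product annihilates
        -- `D (f t)`.
        rw [Multiset.map_cons, Multiset.prod_cons, mul_comm, map_mul] at this
        simpa [D] using this

/-- A solution of `f' = B f` with all eigenvalues of `B` in the open left half plane tends to
`0`. -/
theorem tendsto_zero_of_eigenvalue_re_neg {E : Type*} [NormedAddCommGroup E] [NormedSpace ℂ E]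
    [FiniteDimensional ℂ E] (B : Module.End ℂ E)
    (hB : ∀ a : ℂ, B.HasEigenvalue a → a.re < 0)
    (f : ℝ → E) (hf : ∀ t : ℝ, 0 ≤ t → HasDerivWithinAt f (B (f t)) (Set.Ici 0) t) :
    Tendsto f atTop (𝓝 0) := by
  refine tendsto_zero_of_aeval_prod_eq_zero B (minpoly ℂ B).roots (fun a ha => ?_) f hf fun t => ?_
  · exact hB a (Module.End.hasEigenvalue_of_isRoot (Polynomial.isRoot_of_mem_roots ha))
  · rw [← (IsAlgClosed.splits (minpoly ℂ B)).eq_prod_roots_of_monic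
      (minpoly.monic (Algebra.IsIntegral.isIntegral B)), minpoly.aeval]
    rfl

/-! ### Joint eigenvectors -/

/-- Commuting operators have a common eigenvector in each eigenspace of `P * Q - 1`. -/
theorem exists_joint_eigenvector {E : Type*} [AddCommGroup E] [Module ℂ E]
    [FiniteDimensional ℂ E] {P Q : Module.End ℂ E} (hPQ : Commute P Q) {ν : ℂ}
    (hν : (P * Q - 1).HasEigenvalue ν) :
    ∃ η μ : ℂ, ∃ v : E, v ≠ 0 ∧ P v = η • v ∧ Q v = μ • v ∧ ν = η * μ - 1 := by
  have key : ∀ (p : Submodule ℂ E) (R : Module.End ℂ E), p ≠ ⊥ → Set.MapsTo R p p →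
      ∃ c : ℂ, p ⊓ R.eigenspace c ≠ ⊥ := by
    intro p R hp hR
    have : Nontrivial p := Submodule.nontrivial_iff_ne_bot.2 hp
    obtain ⟨c, hc⟩ := Module.End.exists_eigenvalue (R.restrict hR)
    obtain ⟨v, hv, hv0⟩ := hc.exists_hasEigenvector
    refine ⟨c, (Submodule.ne_bot_iff _).2 ⟨v, ⟨v.2, ?_⟩, by simpa using hv0⟩⟩
    rw [Module.End.mem_eigenspace_iff] at hv
    exact Module.End.mem_eigenspace_iff.2 (congrArg Subtype.val hv)
  have hcP : Commute (P * Q - 1) P :=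
    ((Commute.refl P).mul_left hPQ.symm).sub_left (Commute.one_left P)
  have hcQ : Commute (P * Q - 1) Q :=
    (hPQ.mul_left (Commute.refl Q)).sub_left (Commute.one_left Q)
  obtain ⟨η, hη⟩ := key _ P hν (Module.End.mapsTo_genEigenspace_of_comm hcP ν 1)
  obtain ⟨μ, hμ⟩ := key _ Q hη (fun v hv =>
    ⟨Module.End.mapsTo_genEigenspace_of_comm hcQ ν 1 hv.1,
      Module.End.mapsTo_genEigenspace_of_comm hPQ η 1 hv.2⟩)
  obtain ⟨v, ⟨⟨h1, h2⟩, h3⟩, hv0⟩ := (Submodule.ne_bot_iff _).1 hμ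
  have h1' : (P * Q - 1) v = ν • v := Module.End.mem_eigenspace_iff.1 h1
  have h2' : P v = η • v := Module.End.mem_eigenspace_iff.1 h2
  have h3' : Q v = μ • v := Module.End.mem_eigenspace_iff.1 h3
  refine ⟨η, μ, v, hv0, h2', h3', ?_⟩
  have : (ν - (η * μ - 1)) • v = 0 := by
    rw [sub_smul, ← h1']
    simp only [LinearMap.sub_apply, Module.End.mul_apply, h3', map_smul, h2', Module.End.one_apply]
    module
  exact sub_eq_zero.1 ((smul_eq_zero.1 this).resolve_right hv0)

/-! ### The graph operators and their spectrum -/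

namespace WeightedDigraph

variable {n : ℕ} (G : WeightedDigraph n)

theorem laplacian_diag (i : Fin n) : G.laplacian i i = ∑ j, G.a i j := by
  simp [laplacian, Finset.sum_erase _ (G.a_diag i)]

/-- The operator `1 - L`, acting on vectors with entries in a complex vector space. -/
def averaging (F : Type*) [AddCommGroup F] [Module ℂ F] : Module.End ℂ (Fin n → F) where
  toFun v i := v i + ∑ j, (G.a i j : ℂ) • (v j - v i)
  map_add' v w := by
    ext i
    simp only [Pi.add_apply, add_sub_add_comm, smul_add, Finset.sum_add_distrib]
    abel
  map_smul' c v := by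
    ext i
    simp only [Pi.smul_apply, ← smul_sub, smul_comm _ c, ← Finset.smul_sum, smul_add,
      RingHom.id_apply]

theorem averaging_apply {F : Type*} [AddCommGroup F] [Module ℂ F] (v : Fin n → F) (i : Fin n) :
    G.averaging F v i = v i + ∑ j, (G.a i j : ℂ) • (v j - v i) := rfl

/-- The averaging operator relative to the value at a reference node. -/
def relativeAveraging (r : Fin n) (F : Type*) [AddCommGroup F] [Module ℂ F] :
    Module.End ℂ (Fin n → F) :=
  G.averaging F - LinearMap.pi fun _ => LinearMap.proj r ∘ₗ G.averaging F

theorem relativeAveraging_apply (r : Fin n) {F : Type*} [AddCommGroup F] [Module ℂ F]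
    (v : Fin n → F) (i : Fin n) :
    G.relativeAveraging r F v i = G.averaging F v i - G.averaging F v r := rfl

theorem averaging_compLeft {F F' : Type*} [AddCommGroup F] [Module ℂ F] [AddCommGroup F']
    [Module ℂ F'] (S : F →ₗ[ℂ] F') (v : Fin n → F) (i : Fin n) :
    G.averaging F' (fun j => S (v j)) i = S (G.averaging F v i) := by
  simp [averaging_apply]

theorem averaging_sub_const {F : Type*} [AddCommGroup F] [Module ℂ F] (v : Fin n → F) (c : F)
    (i : Fin n) : G.averaging F (fun j => v j - c) i = G.averaging F v i - c := by
  simp only [averaging_apply, sub_sub_sub_cancel_right]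
  abel

variable {G}

/-- At a maximum of `f` every summand is nonpositive. -/
theorem nonpos_of_sum_eq_const [NeZero n] {f : Fin n → ℝ} {c : ℝ}
    (hf : ∀ i, ∑ j, G.a i j * (f j - f i) = c) : c ≤ 0 := by
  obtain ⟨m, hm⟩ := Finite.exists_max f
  rw [← hf m]
  exact Finset.sum_nonpos fun j _ =>
    mul_nonpos_of_nonneg_of_nonpos (G.a_nonneg m j) (by linarith [hm j])

/-- Where `f` is maximal, vanishing of a sum of nonpositive terms forces the maximal value on all
in-neighbours; it thus propagates backwards along a tree path to the root. -/
theorem le_root_of_harmonic {T : Fin n → Fin n → Prop} (hT : ∀ i j, T i j → G.Edge i j)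
    {r : Fin n} (hr : ∀ j, Relation.ReflTransGen T r j) {f : Fin n → ℝ}
    (hf : ∀ i, ∑ j, G.a i j * (f j - f i) = 0) (i : Fin n) : f i ≤ f r := by
  have : Nonempty (Fin n) := ⟨r⟩
  obtain ⟨m, hm⟩ := Finite.exists_max f
  suffices f r = f m from this ▸ hm i
  refine Relation.ReflTransGen.head_induction_on (motive := fun x _ => f x = f m) (hr m) rfl ?_
  intro x y hxy _ hy
  have hle : ∀ j ∈ Finset.univ, G.a y j * (f j - f y) ≤ 0 := fun j _ =>
    mul_nonpos_of_nonneg_of_nonpos (G.a_nonneg y j) (by linarith [hm j])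
  have h0 := (Finset.sum_eq_zero_iff_of_nonpos hle).1 (hf y) x (Finset.mem_univ x)
  have hpos : 0 < G.a y x := hT x y hxy
  have := (mul_eq_zero.1 h0).resolve_left hpos.ne'
  linarith

/-- Maximum principle: a function with constant Laplacian on a graph with a directed spanning tree
is constant. -/
theorem eq_root_of_sum_eq_const {T : Fin n → Fin n → Prop} (hT : ∀ i j, T i j → G.Edge i j)
    {r : Fin n} (hr : ∀ j, Relation.ReflTransGen T r j) {f : Fin n → ℝ} {c : ℝ}
    (hf : ∀ i, ∑ j, G.a i j * (f j - f i) = c) (i : Fin n) : f i = f r := by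
  have : NeZero n := ⟨(Fin.pos r).ne'⟩
  have hneg : ∀ i, ∑ j, G.a i j * ((-f) j - (-f) i) = -c := fun i => by
    rw [← hf i, ← Finset.sum_neg_distrib]
    exact Finset.sum_congr rfl fun j _ => by simp only [Pi.neg_apply]; ring
  have hc : c = 0 := le_antisymm (nonpos_of_sum_eq_const hf)
    (by linarith [nonpos_of_sum_eq_const hneg])
  subst hc
  refine le_antisymm (le_root_of_harmonic hT hr hf i) ?_
  have := le_root_of_harmonic hT hr (f := -f) (by simpa using hneg) i
  simpa using this

/-- Gershgorin localization of the eigenvalues of `1 - L`. -/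
theorem exists_norm_sub_le_of_averaging_eq {u : Fin n → ℂ} (hu : u ≠ 0) {η : ℂ}
    (h : G.averaging ℂ u = η • u) :
    ∃ i, ‖η - (1 - (∑ j, G.a i j : ℝ))‖ ≤ ∑ j, G.a i j := by
  obtain ⟨k, hk⟩ := Function.ne_iff.1 hu
  have : Nonempty (Fin n) := ⟨k⟩
  -- The disc comes from the row where the eigenvector has largest modulus.
  obtain ⟨m, hm⟩ := Finite.exists_max fun i => ‖u i‖
  have hpos : 0 < ‖u m‖ := (norm_pos_iff.2 hk).trans_le (hm k)
  refine ⟨m, le_of_mul_le_mul_right ?_ hpos⟩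
  have h1 := congrFun h m
  simp only [averaging_apply, smul_eq_mul, Pi.smul_apply, mul_sub, Finset.sum_sub_distrib,
    ← Finset.sum_mul] at h1
  have h2 : (η - (1 - (∑ j, G.a m j : ℝ))) * u m = ∑ j, (G.a m j : ℂ) * u j := by
    push_cast
    linear_combination -h1
  rw [← norm_mul, h2, Finset.sum_mul]
  refine (norm_sum_le _ _).trans (Finset.sum_le_sum fun j _ => ?_)
  rw [norm_mul, Complex.norm_real, Real.norm_of_nonneg (G.a_nonneg m j)]
  exact mul_le_mul_of_nonneg_left (hm j) (G.a_nonneg m j)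

/-- The nonzero eigenvalues of the relative averaging operator differ from `1` and lie in a
Gershgorin disc of `1 - L`. -/
theorem relativeAveraging_eigenvalue {T : Fin n → Fin n → Prop}
    (hT : ∀ i j, T i j → G.Edge i j) {r : Fin n} (hr : ∀ j, Relation.ReflTransGen T r j)
    {v : Fin n → ℂ} (hv : v ≠ 0) {η : ℂ} (h : G.relativeAveraging r ℂ v = η • v) (hη : η ≠ 0) :
    η ≠ 1 ∧ ∃ i, ‖η - (1 - (∑ j, G.a i j : ℝ))‖ ≤ ∑ j, G.a i j := by
  have hvr : v r = 0 := by
    have := congrFun h r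
    rw [relativeAveraging_apply, sub_self, Pi.smul_apply, smul_eq_mul] at this
    exact (mul_eq_zero.1 this.symm).resolve_left hη
  have hi : ∀ i, G.averaging ℂ v i - G.averaging ℂ v r = η * v i := fun i => congrFun h i
  have h1 : η ≠ 1 := by
    rintro rfl
    apply hv
    have hc : ∀ i, ∑ j, (G.a i j : ℂ) * (v j - v i) = G.averaging ℂ v r := fun i => by
      have := hi i
      rw [averaging_apply] at this
      simp only [smul_eq_mul] at this
      linear_combination this
    ext i
    apply Complex.ext
    · have := eq_root_of_sum_eq_const hT hr (f := fun j => (v j).re)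
        (c := (G.averaging ℂ v r).re) (fun i => by rw [← hc i]; simp) i
      simpa [hvr] using this
    · have := eq_root_of_sum_eq_const hT hr (f := fun j => (v j).im)
        (c := (G.averaging ℂ v r).im) (fun i => by rw [← hc i]; simp) i
      simpa [hvr] using this
  have h1' : η - 1 ≠ 0 := sub_ne_zero.2 h1
  -- With `a` the value of `(1 - L) v` at `r`, one has `(1 - L) v = η v + a`; the shift `c = -a / (η
  -- - 1)` solves `a - c = -η c`, making `v - c` an eigenvector of `1 - L`.
  refine ⟨h1, exists_norm_sub_le_of_averaging_eq
    (u := fun j => v j - (-(G.averaging ℂ v r / (η - 1)))) ?_ ?_⟩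
  · intro h0
    have h2 : ∀ i, v i = -(G.averaging ℂ v r / (η - 1)) := fun i => sub_eq_zero.1 (congrFun h0 i)
    exact hv (funext fun i => by rw [h2 i, ← h2 r, hvr]; rfl)
  · ext i
    rw [averaging_sub_const, Pi.smul_apply, smul_eq_mul]
    have h3 : G.averaging ℂ v i = G.averaging ℂ v r + η * v i := by linear_combination hi i
    rw [h3]
    field_simp
    ring

end WeightedDigraph

/-! ### Spectral inequality and stability of the generator -/

/-- The spectral inequality behind the in-degree bound. -/
theorem re_mul_lt_one_of_lt_inDegreeBound {μ η : ℂ} {b l : ℝ} (hμ : μ ≠ 1 → μ.re < 1)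
    (hb : b < inDegreeBound μ) (hl0 : 0 ≤ l) (hlb : l ≤ b) (hη1 : η ≠ 1)
    (hη : ‖η - (1 - (l : ℂ))‖ ≤ l) : (η * μ).re < 1 := by
  by_cases h1 : μ = 1
  · subst h1
    rw [mul_one]
    have hsq : (η.re - (1 - l)) ^ 2 + η.im ^ 2 ≤ l ^ 2 := by
      have := pow_le_pow_left₀ (norm_nonneg _) hη 2
      rw [Complex.sq_norm, Complex.normSq_apply] at this
      simp at this
      linarith
    by_contra! hre
    -- The disc meets the half plane `Re ≥ 1` only at the point `1`.
    have him : η.im ^ 2 ≤ 0 := by nlinarith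
    have him0 : η.im = 0 := by simpa using le_antisymm him (sq_nonneg _)
    have hre1 : η.re ≤ 1 := by
      rw [him0] at hsq
      nlinarith [abs_le_of_sq_le_sq' (by simpa using hsq) hl0]
    exact hη1 (Complex.ext (le_antisymm hre1 hre) him0)
  have hre := hμ h1
  have hmain : (η * μ).re ≤ μ.re + b * (‖μ‖ - μ.re) := by
    have h2 : (η * μ).re = (1 - l) * μ.re + ((η - (1 - (l : ℂ))) * μ).re := by
      simp
      ring
    have h3 : ((η - (1 - (l : ℂ))) * μ).re ≤ l * ‖μ‖ :=
      (Complex.re_le_norm _).trans (by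
        rw [norm_mul]
        exact mul_le_mul_of_nonneg_right hη (norm_nonneg _))
    have h4 := Complex.re_le_norm μ
    nlinarith
  refine hmain.trans_lt ?_
  rw [inDegreeBound] at hb
  split_ifs at hb with him
  · have habs : ‖μ‖ = |μ.re| := by
      rw [← Complex.re_add_im μ, him]
      simp
    rw [habs]
    -- For negative `μ` the bound equals `(1 - 2 b) μ`, nonpositive because `b < 1/2`.
    rcases le_total 0 μ.re with h | h
    · rw [abs_of_nonneg h]
      linarith
    · rw [abs_of_nonpos h]
      nlinarith
  · have hμ0 : μ ≠ 0 := by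
      rintro rfl
      exact him rfl
    have hρ : 0 < ‖μ‖ := norm_pos_iff.2 hμ0
    set c := Real.cos μ.arg with hc
    set s := Real.sin μ.arg with hs
    have hcre : ‖μ‖ * c = μ.re := Complex.norm_mul_cos_arg μ
    have hsim : ‖μ‖ * s = μ.im := Complex.norm_mul_sin_arg μ
    have hs0 : s ≠ 0 := by
      intro h
      rw [h, mul_zero] at hsim
      exact him hsim.symm
    -- This cancels `1 + cos θ` and turns the bound into `(1 - Re μ) / (|μ| - Re μ)`.
    have hsc : s ^ 2 = (1 - c) * (1 + c) := by
      have := Real.sin_sq_add_cos_sq μ.arg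
      rw [← hc, ← hs] at this
      linear_combination this
    have hs2 : 0 < s ^ 2 := by positivity
    have hc1 : 0 < 1 + c := by
      have h2 : 0 ≤ 1 + c := by linarith [Real.neg_one_le_cos μ.arg]
      exact lt_of_le_of_ne h2 fun h => by rw [hsc, ← h, mul_zero] at hs2; exact lt_irrefl _ hs2
    have hb1 := hb.trans_le (min_le_left _ _)
    rw [hcre, abs_of_pos (by linarith), lt_div_iff₀ (by positivity), hsc] at hb1
    have h5 : b * (‖μ‖ * (1 - c)) < 1 - μ.re := by
      refine lt_of_mul_lt_mul_right ?_ hc1.le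
      linarith
    have h6 : ‖μ‖ * (1 - c) = ‖μ‖ - μ.re := by rw [← hcre]; ring
    rw [h6] at h5
    linarith

/-- The generator of the complexified disagreement dynamics is stable. -/
theorem disagreement_eigenvalue_re_neg {n d : ℕ} [NeZero n] {G : WeightedDigraph n}
    {C : Matrix (Fin d) (Fin d) ℝ} (hC : ∀ μ : ℂ, IsEigenvalueOf C μ → μ ≠ 1 → μ.re < 1)
    (hl : ∀ μ : ℂ, IsEigenvalueOf C μ → G.maxInDegree < inDegreeBound μ)
    {T : Fin n → Fin n → Prop} (hT : ∀ i j, T i j → G.Edge i j) {r : Fin n}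
    (hr : ∀ j, Relation.ReflTransGen T r j) {ν : ℂ}
    (hν : (G.relativeAveraging r (Fin d → ℂ) *
      (Matrix.toLin' (complexify C)).compLeft (Fin n) - 1).HasEigenvalue ν) : ν.re < 0 := by
  have hcomm : Commute (G.relativeAveraging r (Fin d → ℂ))
      ((Matrix.toLin' (complexify C)).compLeft (Fin n)) := by
    refine LinearMap.ext fun v => funext fun i => ?_
    simp only [Module.End.mul_apply, WeightedDigraph.relativeAveraging_apply]
    change G.averaging _ (fun j => Matrix.toLin' (complexify C) (v j)) i -
      G.averaging _ (fun j => Matrix.toLin' (complexify C) (v j)) r =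
      Matrix.toLin' (complexify C) (G.averaging _ v i - G.averaging _ v r)
    rw [G.averaging_compLeft, G.averaging_compLeft, map_sub]
  obtain ⟨η, μ, v, hv0, hη, hμ, rfl⟩ := exists_joint_eigenvector hcomm hν
  obtain ⟨i, hi⟩ := Function.ne_iff.1 hv0
  obtain ⟨k, hk⟩ := Function.ne_iff.1 hi
  have hμe : IsEigenvalueOf C μ :=
    Module.End.hasEigenvalue_of_hasEigenvector (x := v i)
      ⟨Module.End.mem_eigenspace_iff.2 (congrFun hμ i), hi⟩
  suffices (η * μ).re < 1 by simpa using this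
  by_cases hη0 : η = 0
  · simp [hη0]
  -- `P` acts separately on each of the `d` coordinates, so a nonzero coordinate slice is a scalar
  -- eigenvector.
  have hcol : G.relativeAveraging r ℂ (fun j => v j k) = η • fun j => v j k := by
    ext j
    have := congrFun (congrFun hη j) k
    rw [G.relativeAveraging_apply] at this ⊢
    have hp : ∀ j, G.averaging ℂ (fun j => v j k) j = G.averaging (Fin d → ℂ) v j k := fun j =>
      G.averaging_compLeft (LinearMap.proj k : (Fin d → ℂ) →ₗ[ℂ] ℂ) v j
    rw [hp, hp]
    exact this
  obtain ⟨hη1, m, hm⟩ := WeightedDigraph.relativeAveraging_eigenvalue hT hr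
    (Function.ne_iff.2 ⟨i, hk⟩) hcol hη0
  refine re_mul_lt_one_of_lt_inDegreeBound (hC μ hμe) (hl μ hμe)
    (Finset.sum_nonneg fun j _ => G.a_nonneg m j) ?_ hη1 hm
  rw [← G.laplacian_diag]
  exact Finset.le_sup' (fun i => G.laplacian i i) (Finset.mem_univ m)

/-! ### Disagreement dynamics and consensus -/

/-- The complexified disagreement with respect to a reference node. -/
def disagreement {n d : ℕ} (x : ℝ → Fin n → EuclideanSpace ℝ (Fin d)) (r : Fin n) (t : ℝ) :
    Fin n → Fin d → ℂ :=
  fun i k => (x t i k : ℂ) - (x t r k : ℂ)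

theorem IsModelOneSolution.hasDerivWithinAt_apply {n d : ℕ} {G : WeightedDigraph n}
    {C : Matrix (Fin d) (Fin d) ℝ} {x : ℝ → Fin n → EuclideanSpace ℝ (Fin d)}
    (hx : IsModelOneSolution G C x) {t : ℝ} (ht : 0 ≤ t) (i : Fin n) (k : Fin d) :
    HasDerivWithinAt (fun s => (x s i k : ℂ))
      (G.averaging (Fin d → ℂ)
        (fun j => Matrix.toLin' (complexify C) fun l => (x t j l : ℂ)) i k - (x t i k : ℂ))
      (Set.Ici 0) t := by
  have h1 := ((EuclideanSpace.proj (𝕜 := ℝ) k).hasFDerivAt.comp_hasDerivWithinAt t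
    (hx t ht i)).ofReal_comp
  have hS : ∀ y : EuclideanSpace ℝ (Fin d),
      Matrix.toLin' (complexify C) (fun l => (y l : ℂ)) k =
        ((Matrix.toEuclideanLin C y k : ℝ) : ℂ) := fun y => by
    simp [complexify, Matrix.mulVec, dotProduct, Matrix.toLpLin_apply]
  have hN : ∀ f : Fin n → ℝ, ∑ j ∈ G.inNeighbors i, G.a i j * f j = ∑ j, G.a i j * f j := by
    intro f
    refine Finset.sum_subset (Finset.subset_univ _) fun j _ hj => ?_
    classical
    have : ¬ 0 < G.a i j := fun h => hj (Finset.mem_filter.2 ⟨Finset.mem_univ j, h⟩)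
    rw [le_antisymm (not_lt.1 this) (G.a_nonneg i j), zero_mul]
  convert! h1 using 1
  have hsum := hN fun j => Matrix.toEuclideanLin C (x t j) k - Matrix.toEuclideanLin C (x t i) k
  simp only [WeightedDigraph.averaging_apply, Pi.add_apply, Finset.sum_apply, Pi.smul_apply,
    Pi.sub_apply, hS, smul_eq_mul]
  rw [map_add, map_sum]
  simp only [map_smul, map_sub, PiLp.proj_apply, LinearMap.sub_apply, smul_eq_mul]
  rw [hsum]
  have hone : Matrix.toEuclideanLin (1 : Matrix (Fin d) (Fin d) ℝ) (x t i) k = x t i k := by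
    simp
  rw [hone]
  push_cast
  ring

/-- Replacing `x_j` by `x_j - x_r` shifts every averaged value by the same vector `C x_r`, which
cancels on subtracting row `r`. -/
theorem IsModelOneSolution.hasDerivWithinAt_disagreement {n d : ℕ} {G : WeightedDigraph n}
    {C : Matrix (Fin d) (Fin d) ℝ} {x : ℝ → Fin n → EuclideanSpace ℝ (Fin d)}
    (hx : IsModelOneSolution G C x) (r : Fin n) {t : ℝ} (ht : 0 ≤ t) :
    HasDerivWithinAt (disagreement x r)
      ((G.relativeAveraging r (Fin d → ℂ) *
        (Matrix.toLin' (complexify C)).compLeft (Fin n) - 1) (disagreement x r t))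
      (Set.Ici 0) t := by
  rw [hasDerivWithinAt_pi]
  intro i
  rw [hasDerivWithinAt_pi]
  intro k
  have h := (hx.hasDerivWithinAt_apply ht i k).sub (hx.hasDerivWithinAt_apply ht r k)
  convert! h using 1
  have hQ : (Matrix.toLin' (complexify C)).compLeft (Fin n) (disagreement x r t) =
      fun j => Matrix.toLin' (complexify C) (fun l => (x t j l : ℂ)) -
        Matrix.toLin' (complexify C) (fun l => (x t r l : ℂ)) := by
    funext j
    rw [← map_sub]
    rfl
  rw [LinearMap.sub_apply, Module.End.mul_apply, hQ, Pi.sub_apply, Pi.sub_apply,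
    G.relativeAveraging_apply, G.averaging_sub_const, G.averaging_sub_const, Module.End.one_apply,
    sub_sub_sub_cancel_right, Pi.sub_apply]
  simp only [disagreement]
  ring

theorem mainTheorem4 {n d : ℕ} [NeZero n] (G : WeightedDigraph n) (C : Matrix (Fin d) (Fin d) ℝ)
    (hG : G.HasDirectedSpanningTree) (hC : IsLogicMatrix C)
    (hl : ∀ μ : ℂ, IsEigenvalueOf C μ → G.maxInDegree < inDegreeBound μ)
    (x : ℝ → Fin n → EuclideanSpace ℝ (Fin d)) (hx : IsModelOneSolution G C x) :
    ReachesConsensus x := by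
  obtain ⟨T, hT, r, -, -, hr⟩ := hG
  have hlim : Tendsto (disagreement x r) atTop (𝓝 0) :=
    tendsto_zero_of_eigenvalue_re_neg _
      (fun ν hν => disagreement_eigenvalue_re_neg hC.re_lt_one hl hT hr hν) _
      fun t ht => hx.hasDerivWithinAt_disagreement r ht
  have hre : ∀ i k, Tendsto (fun t => x t i k - x t r k) atTop (𝓝 0) := by
    intro i k
    have h := (Complex.continuous_re.tendsto _).comp
      (tendsto_pi_nhds.1 (tendsto_pi_nhds.1 hlim i) k)
    simpa [Function.comp_def, disagreement] using h
  intro i j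
  rw [← tendsto_zero_iff_norm_tendsto_zero]
  have hij : Tendsto (fun t => WithLp.ofLp (x t i - x t j)) atTop (𝓝 0) := by
    rw [tendsto_pi_nhds]
    intro k
    simpa using (hre i k).sub (hre j k)
  exact ((PiLp.continuous_toLp 2 fun _ : Fin d => ℝ).tendsto 0).comp hij
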